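/- All Lie algebras are real and finite-dimensional; $B_{\mathfrak l}$ denotes the Killing form of $\mathfrak l$. Let $(\mathfrak g,\langle\cdot,\cdot\rangle_{\mathfrak g})$ be a Lie algebra with an $\mathrm{ad}$-invariant scalar product (symmetric, non-degenerate, of any signature), let $\mathfrak h$ be a Lie algebra with an $\mathrm{ad}$-invariant symmetric, possibly degenerate, bilinear form $\langle\cdot,\cdot\rangle_{\mathfrak h}$, and let $\pi:\mathfrak h\to \mathrm{Der}_a(\mathfrak g,\langle\cdot,\cdot\rangle_{\mathfrak g})$ be a Lie algebra homomorphism into the antisymmetric derivations of $\mathfrak g$. The double extension $\mathfrak d_\pi=\mathfrak h^*\oplus\mathfrak g\oplus\mathfrak h$ has the bracket $$[(\alpha,X,H),(\tilde\alpha,\tilde X,\tilde H)]=\big(\beta(X,\tilde X)+\mathrm{ad}^*(H)\tilde\alpha-\mathrm{ad}^*(\tilde H)\alpha,\ [X,\tilde X]+\pi(H)\tilde X-\pi(\tilde H)X,\ [H,\tilde H]\big),$$ where $\beta(X,\tilde X)(H)=\langle\pi(H)X,\tilde X\rangle_{\mathfrak g}$ and $(\mathrm{ad}^*(H)\alpha)(\tilde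 H)=-\alpha([H,\tilde H])$, and the $\mathrm{ad}$-invariant scalar product $$\langle(\alpha,X,H),(\tilde\alpha,\tilde X,\tilde H)\rangle=\langle H,\tilde H\rangle_{\mathfrak h}+\langle X,\tilde X\rangle_{\mathfrak g}+\alpha(\tilde H)+\tilde\alpha(H).$$ Let $G$ and $D_\pi$ be Lie groups with Lie algebras $\mathfrak g$ and $\mathfrak d_\pi$ (for instance the simply connected ones), each with the left-invariant pseudo-Riemannian metric given by the scalar product of its Lie algebra. Let $\mathrm{Ric}$ be the Ricci tensor and $R$ the scalar curvature of the Levi-Civita connection; elements of the Lie algebra are regarded as left-invariant vector fields. Then: a) For all $X,Y\in\mathfrak g$, $H,\tilde H\in\mathfrak h$, $\alpha\in\mathfrak h^*$, $Z\in\mathfrak d_\pi$: $$\mathrm{Ric}^{D_\pi}(X,Y)=\mathrm{Ric}^{G}(X,Y)=-\tfrac14B_{\mathfrak g}(X,Y),\qquad \mathrm{Ric}^{D_\pi}(\alpha,Z)=0,$$ $$\mathrm{Ric}^{D_\pi}(H,\tilde H)=-\tfrac14\big(\mathrm{tr}_{\mathfrak g}(\pi(H)\circ\pi(\tilde H))+2B_{\mathfrak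 h}(H,\tilde H)\big),\qquad \mathrm{Ric}^{D_\pi}(X,H)=-\tfrac14\,\mathrm{tr}_{\mathfrak g}(\mathrm{ad}_{\mathfrak g}(X)\circ\pi(H)),$$ and likewise with the two arguments of $\mathrm{Ric}^{D_\pi}$ interchanged. b) $R^{D_\pi}=R^{G}=-\tfrac14\,\mathrm{tr}_{\mathfrak g}B_{\mathfrak g}$, where $\mathrm{tr}_{\mathfrak g}B_{\mathfrak g}$ is the trace of $B_{\mathfrak g}$ with respect to $\langle\cdot,\cdot\rangle_{\mathfrak g}$. Call the Ricci tensor 2-step nilpotent if, regarded by means of the metric as an endomorphism of the tangent bundle, it satisfies $\mathrm{Ric}\circ\mathrm{Ric}=0$. Then moreover: 1. Let $X_1,\dots,X_n$ be any orthonormal basis of $\mathfrak g$, $\langle X_i,X_j\rangle_{\mathfrak g}=\varepsilon_i\delta_{ij}$ with $\varepsilon_i=\pm1$. The Ricci tensor of $D_\pi$ is 2-step nilpotent if and only if the Ricci tensor of $G$ is 2-step nilpotent and, for all $H,\tilde H\in\mathfrak h$ and $X\in\mathfrak g$, $$\sum_{j=1}^n\varepsilon_jB_{\mathfrak g}(X,X_j)\,\mathrm{tr}_{\mathfrak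 g}(\mathrm{ad}_{\mathfrak g}(X_j)\circ\pi(H))=0,\qquad \sum_{j=1}^n\varepsilon_j\,\mathrm{tr}_{\mathfrak g}(\mathrm{ad}_{\mathfrak g}(X_j)\circ\pi(H))\,\mathrm{tr}_{\mathfrak g}(\mathrm{ad}_{\mathfrak g}(X_j)\circ\pi(\tilde H))=0.$$ 2. $D_\pi$ is Ricci-flat if and only if, for all $X\in\mathfrak g$ and $H,\tilde H\in\mathfrak h$, $$B_{\mathfrak g}=0,\qquad \mathrm{tr}_{\mathfrak g}(\mathrm{ad}_{\mathfrak g}(X)\circ\pi(H))=0,\qquad \mathrm{tr}_{\mathfrak g}(\pi(H)\circ\pi(\tilde H))+2B_{\mathfrak h}(H,\tilde H)=0.$$ -/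

import Mathlib

open Module
open scoped Manifold ContDiff

noncomputable section

/-! ## Metric Lie algebras and double extensions -/

/-- An ad-invariant symmetric bilinear form on a real Lie algebra (it may be degenerate). -/
structure InvariantForm (𝔩 : Type*) [LieRing 𝔩] [LieAlgebra ℝ 𝔩] where
  form : LinearMap.BilinForm ℝ 𝔩
  symm : form.IsSymm
  invariant : form.lieInvariant 𝔩

/-- An ad-invariant scalar product, of arbitrary signature, on a real Lie algebra. A Lie algebra
with such a scalar product is a metric Lie algebra. -/
structure InvariantScalarProduct (𝔩 : Type*) [LieRing 𝔩] [LieAlgebra ℝ 𝔩]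
    extends InvariantForm 𝔩 where
  nondegenerate : form.Nondegenerate

section DoubleExtension

variable {𝔤 𝔥 : Type*} [LieRing 𝔤] [LieAlgebra ℝ 𝔤] [LieRing 𝔥] [LieAlgebra ℝ 𝔥]

/-- The Lie algebra of all derivations of `𝔤` that are antisymmetric with respect to the scalar
product `B`. -/
def skewDerivations (B : InvariantScalarProduct 𝔤) :
    LieSubalgebra ℝ (LieDerivation ℝ 𝔤 𝔤) where
  carrier := {D | ∀ X Y : 𝔤, B.form (D X) Y = -B.form X (D Y)}
  add_mem' {D D'} hD hD' X Y := by
    simp only [Set.mem_ofPred_eq] at hD hD'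
    simp only [LieDerivation.add_apply, map_add, LinearMap.add_apply, hD X Y, hD' X Y]
    ring
  zero_mem' X Y := by simp
  smul_mem' c D hD X Y := by
    simp only [Set.mem_ofPred_eq] at hD
    simp [hD X Y]
  lie_mem' {D D'} hD hD' X Y := by
    replace hD : ∀ X Y : 𝔤, B.form (D X) Y = -B.form X (D Y) := hD
    replace hD' : ∀ X Y : 𝔤, B.form (D' X) Y = -B.form X (D' Y) := hD'
    simp only [LieDerivation.commutator_apply, map_sub, LinearMap.sub_apply, hD _ _, hD' _ _]
    ring

variable {B : InvariantScalarProduct 𝔤}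

/-- The endomorphism `π(H)` of `𝔤`. -/
def skewAction (π : 𝔥 →ₗ⁅ℝ⁆ skewDerivations B) : 𝔥 →ₗ[ℝ] Module.End ℝ 𝔤 where
  toFun H := ((π H : LieDerivation ℝ 𝔤 𝔤) : 𝔤 →ₗ[ℝ] 𝔤)
  map_add' H H' := by simp
  map_smul' c H := by simp

lemma skewAction_lie (π : 𝔥 →ₗ⁅ℝ⁆ skewDerivations B) (H : 𝔥) (X Y : 𝔤) :
    skewAction π H ⁅X, Y⁆ = ⁅X, skewAction π H Y⁆ + ⁅skewAction π H X, Y⁆ :=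
  LieDerivation.apply_lie_eq_add _ X Y

lemma skewAction_skew (π : 𝔥 →ₗ⁅ℝ⁆ skewDerivations B) (H : 𝔥) (X Y : 𝔤) :
    B.form (skewAction π H X) Y = -B.form X (skewAction π H Y) :=
  (π H).2 X Y

lemma skewAction_bracket (π : 𝔥 →ₗ⁅ℝ⁆ skewDerivations B) (H H' : 𝔥) (X : 𝔤) :
    skewAction π ⁅H, H'⁆ X =
      skewAction π H (skewAction π H' X) - skewAction π H' (skewAction π H X) := by
  change (π ⁅H, H'⁆ : LieDerivation ℝ 𝔤 𝔤) X = _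
  rw [LieHom.map_lie, LieSubalgebra.coe_bracket, LieDerivation.commutator_apply]
  rfl

/-- The cocycle `β(X, Y)(H) = ⟨π(H) X, Y⟩`. -/
def extensionCocycle (π : 𝔥 →ₗ⁅ℝ⁆ skewDerivations B) (X Y : 𝔤) : Dual ℝ 𝔥 where
  toFun H := B.form (skewAction π H X) Y
  map_add' H H' := by simp
  map_smul' c H := by simp

/-- The underlying space `𝔥* ⊕ 𝔤 ⊕ 𝔥` of the double extension of the metric Lie algebra `𝔤` with
respect to `π`. -/
@[ext] structure DoubleExtension (π : 𝔥 →ₗ⁅ℝ⁆ skewDerivations B) where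
  dual : Dual ℝ 𝔥
  mid : 𝔤
  top : 𝔥

namespace DoubleExtension

variable {π : 𝔥 →ₗ⁅ℝ⁆ skewDerivations B}

def toProd : DoubleExtension π ≃ Dual ℝ 𝔥 × 𝔤 × 𝔥 where
  toFun x := (x.dual, x.mid, x.top)
  invFun x := ⟨x.1, x.2.1, x.2.2⟩
  left_inv _ := rfl
  right_inv _ := rfl

instance : AddCommGroup (DoubleExtension π) := toProd.addCommGroup

instance : Module ℝ (DoubleExtension π) := toProd.module ℝ

@[simp] lemma zero_dual : (0 : DoubleExtension π).dual = 0 := rfl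
@[simp] lemma zero_mid : (0 : DoubleExtension π).mid = 0 := rfl
@[simp] lemma zero_top : (0 : DoubleExtension π).top = 0 := rfl
@[simp] lemma add_dual (x y : DoubleExtension π) : (x + y).dual = x.dual + y.dual := rfl
@[simp] lemma add_mid (x y : DoubleExtension π) : (x + y).mid = x.mid + y.mid := rfl
@[simp] lemma add_top (x y : DoubleExtension π) : (x + y).top = x.top + y.top := rfl
@[simp] lemma smul_dual (c : ℝ) (x : DoubleExtension π) : (c • x).dual = c • x.dual := rfl
@[simp] lemma smul_mid (c : ℝ) (x : DoubleExtension π) : (c • x).mid = c • x.mid := rfl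
@[simp] lemma smul_top (c : ℝ) (x : DoubleExtension π) : (c • x).top = c • x.top := rfl

/-- The commutator of the double extension. Here `⁅H, α⁆`, for `H` in `𝔥` and `α` in `𝔥*`, is the
coadjoint action `⁅H, α⁆ (H') = -α ⁅H, H'⁆`. -/
instance : Bracket (DoubleExtension π) (DoubleExtension π) where
  bracket x y :=
    { dual := extensionCocycle π x.mid y.mid + ⁅x.top, y.dual⁆ - ⁅y.top, x.dual⁆
      mid := ⁅x.mid, y.mid⁆ + skewAction π x.top y.mid - skewAction π y.top x.mid
      top := ⁅x.top, y.top⁆ }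

lemma lie_dual_apply (x y : DoubleExtension π) (H : 𝔥) :
    ⁅x, y⁆.dual H =
      B.form (skewAction π H x.mid) y.mid - y.dual ⁅x.top, H⁆ + x.dual ⁅y.top, H⁆ := by
  change (extensionCocycle π x.mid y.mid + ⁅x.top, y.dual⁆ - ⁅y.top, x.dual⁆) H = _
  simp [extensionCocycle]
  ring

@[simp] lemma lie_mid (x y : DoubleExtension π) :
    ⁅x, y⁆.mid = ⁅x.mid, y.mid⁆ + skewAction π x.top y.mid - skewAction π y.top x.mid := rfl

@[simp] lemma lie_top (x y : DoubleExtension π) : ⁅x, y⁆.top = ⁅x.top, y.top⁆ := rfl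

instance : LieRing (DoubleExtension π) where
  add_lie x y z := by
    ext H
    · simp [lie_dual_apply]; ring
    · simp; abel
    · simp
  lie_add x y z := by
    ext H
    · simp [lie_dual_apply]; ring
    · simp; abel
    · simp
  lie_self x := by
    ext H
    · have h := skewAction_skew π H x.mid x.mid
      rw [B.symm.eq x.mid] at h
      simp [lie_dual_apply]
      linarith
    · simp
    · simp
  leibniz_lie x y z := by
    ext H
    · have inv := fun a b c : 𝔤 => B.invariant a b c
      have skew := fun (K : 𝔥) (a b : 𝔤) => skewAction_skew π K a b
      have e₁ : B.form x.mid ⁅y.mid, skewAction π H z.mid⁆ =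
          -B.form y.mid ⁅x.mid, skewAction π H z.mid⁆ := by
        have h₁ := inv y.mid x.mid (skewAction π H z.mid)
        have h₂ := inv x.mid y.mid (skewAction π H z.mid)
        rw [← lie_skew, map_neg, LinearMap.neg_apply] at h₂
        linarith
      have e₂ : B.form x.mid ⁅skewAction π H y.mid, z.mid⁆ =
          B.form y.mid ⁅x.mid, skewAction π H z.mid⁆ +
            B.form y.mid ⁅skewAction π H x.mid, z.mid⁆ := by
        have h₁ := inv (skewAction π H y.mid) x.mid z.mid
        have h₂ := inv x.mid (skewAction π H y.mid) z.mid
        rw [← lie_skew, map_neg, LinearMap.neg_apply, skew, skewAction_lie, map_add] at h₂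
        linarith
      have e₃ : B.form x.mid (skewAction π z.top (skewAction π H y.mid)) =
          B.form y.mid (skewAction π H (skewAction π z.top x.mid)) := by
        have h₁ := skew z.top x.mid (skewAction π H y.mid)
        have h₂ := skew H y.mid (skewAction π z.top x.mid)
        rw [B.symm.eq] at h₁
        linarith
      simp only [lie_dual_apply, lie_mid, lie_top, add_dual, LinearMap.add_apply, map_add,
        map_sub, LinearMap.sub_apply, skewAction_lie, skewAction_bracket, lie_lie, inv, skew]
      linarith
    · have h := lie_skew y.mid (skewAction π z.top x.mid)
      simp only [lie_mid, lie_top, add_mid, lie_add, add_lie, lie_sub, sub_lie, map_add, map_sub,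
        skewAction_lie, skewAction_bracket, lie_lie, ← h]
      abel
    · simp

instance : LieAlgebra ℝ (DoubleExtension π) where
  lie_smul c x y := by
    ext H
    · simp [lie_dual_apply]; ring
    · simp [smul_sub, smul_add]
    · simp

/-- The inclusion of `𝔥*`. -/
def inDual (α : Dual ℝ 𝔥) : DoubleExtension π := ⟨α, 0, 0⟩

/-- The inclusion of `𝔤`. -/
def inMid (X : 𝔤) : DoubleExtension π := ⟨0, X, 0⟩

/-- The inclusion of `𝔥`. -/
def inTop (H : 𝔥) : DoubleExtension π := ⟨0, 0, H⟩

/-- The ad-invariant scalar product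
`⟨(α, X, H), (α', X', H')⟩ = ⟨H, H'⟩ + ⟨X, X'⟩ + α(H') + α'(H)` of the double extension. -/
def scalarProduct (π : 𝔥 →ₗ⁅ℝ⁆ skewDerivations B) (Bh : InvariantForm 𝔥) :
    InvariantScalarProduct (DoubleExtension π) where
  form := LinearMap.mk₂ ℝ
    (fun x y => Bh.form x.top y.top + B.form x.mid y.mid + x.dual y.top + y.dual x.top)
    (fun x x' y => by simp; ring) (fun c x y => by simp; ring)
    (fun x y y' => by simp; ring) (fun c x y => by simp; ring)
  symm := ⟨fun x y => by
    simp only [LinearMap.mk₂_apply, Bh.symm.eq x.top, B.symm.eq x.mid]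
    ring⟩
  invariant x y z := by
    have h₁ := Bh.invariant x.top y.top z.top
    have h₂ := B.invariant x.mid y.mid z.mid
    have h₃ := skewAction_skew π x.top y.mid z.mid
    have h₄ := skewAction_skew π y.top x.mid z.mid
    have h₅ := skewAction_skew π z.top x.mid y.mid
    have h₆ := B.symm.eq y.mid (skewAction π z.top x.mid)
    have h₇ : z.dual ⁅y.top, x.top⁆ = -z.dual ⁅x.top, y.top⁆ := by rw [← lie_skew, map_neg]
    have h₈ : x.dual ⁅z.top, y.top⁆ = -x.dual ⁅y.top, z.top⁆ := by rw [← lie_skew, map_neg]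
    simp only [LinearMap.mk₂_apply, lie_dual_apply, lie_mid, lie_top, map_add, map_sub,
      LinearMap.add_apply, LinearMap.sub_apply]
    linarith
  nondegenerate := by
    have key : ∀ x : DoubleExtension π,
        (∀ y : DoubleExtension π, Bh.form x.top y.top + B.form x.mid y.mid + x.dual y.top
          + y.dual x.top = 0) → x = 0 := by
      intro x hx
      have htop : x.top = 0 := by
        rw [← forall_dual_apply_eq_zero_iff ℝ]
        intro α
        simpa [inDual] using hx (inDual α)
      have hmid : x.mid = 0 := B.nondegenerate.1 x.mid fun Y => by
        simpa [inMid] using hx (inMid Y)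
      ext H
      · simpa [inTop, htop] using hx (inTop H)
      · exact hmid
      · exact htop
    refine ⟨fun x hx => key x fun y => by simpa using hx y, fun y hy => key y fun x => ?_⟩
    have h := hy x
    simp only [LinearMap.mk₂_apply, Bh.symm.eq x.top, B.symm.eq x.mid] at h
    linarith

end DoubleExtension

end DoubleExtension

/-! ## Orthonormal bases and contractions with a scalar product -/

section Contraction

variable {V : Type*} [AddCommGroup V] [Module ℝ V]

/-- `b` is an orthonormal basis for the scalar product `g`, with signs `ε j = ⟨b j, b j⟩ = ±1`. -/
structure IsPseudoOrthonormal (g : LinearMap.BilinForm ℝ V) {n : ℕ} (b : Basis (Fin n) ℝ V)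
    (ε : Fin n → ℝ) : Prop where
  sign : ∀ j, ε j = 1 ∨ ε j = -1
  self : ∀ j, g (b j) (b j) = ε j
  orthogonal : ∀ i j, i ≠ j → g (b i) (b j) = 0

variable [FiniteDimensional ℝ V]

/-- The endomorphism `A` with `g (A v) w = T v w`, that is, `T` with one index raised by `g`. -/
def raiseIndex (g : LinearMap.BilinForm ℝ V) (hg : g.Nondegenerate)
    (T : LinearMap.BilinForm ℝ V) : Module.End ℝ V :=
  T.symmCompOfNondegenerate g hg

/-- The trace of the bilinear form `T` with respect to the scalar product `g`. -/
def metricTrace (g : LinearMap.BilinForm ℝ V) (hg : g.Nondegenerate)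
    (T : LinearMap.BilinForm ℝ V) : ℝ :=
  LinearMap.trace ℝ V (raiseIndex g hg T)

end Contraction

/-! ## The Levi-Civita connection and curvature -/

section Manifold

variable {E : Type*} [NormedAddCommGroup E] [NormedSpace ℝ E] [FiniteDimensional ℝ E]
  {M : Type*} [TopologicalSpace M] [ChartedSpace E M] [IsManifold 𝓘(ℝ, E) ∞ M]

/-- The connection `∇` on the tangent bundle is the Levi-Civita connection of the
pseudo-Riemannian metric `g`: it is torsion-free, and `v ⟨Y, Z⟩ = ⟨∇_v Y, Z⟩ + ⟨Y, ∇_v Z⟩`.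
Beware of the order of the arguments: `∇ Y x v` is `∇_v Y`. -/
structure IsLeviCivita (g : Π x : M, LinearMap.BilinForm ℝ (TangentSpace 𝓘(ℝ, E) x))
    (cov : CovariantDerivative 𝓘(ℝ, E) E (TangentSpace 𝓘(ℝ, E) : M → Type _)) : Prop where
  torsion_eq_zero : cov.torsion = 0
  metric : ∀ (Y Z : Π x : M, TangentSpace 𝓘(ℝ, E) x) (x : M), MDiffAt (T% Y) x →
    MDiffAt (T% Z) x → ∀ v : TangentSpace 𝓘(ℝ, E) x,
      mvfderiv 𝓘(ℝ, E) (fun y => g y (Y y) (Z y)) x v =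
        g x (cov Y x v) (Z x) + g x (Y x) (cov Z x v)

/-- The curvature `R(X, Y) Z = ∇_X ∇_Y Z - ∇_Y ∇_X Z - ∇_[X, Y] Z` of vector fields. -/
def curvatureField (cov : CovariantDerivative 𝓘(ℝ, E) E (TangentSpace 𝓘(ℝ, E) : M → Type _))
    (X Y Z : Π x : M, TangentSpace 𝓘(ℝ, E) x) (x : M) : TangentSpace 𝓘(ℝ, E) x :=
  cov (fun y => cov Z y (Y y)) x (X x) - cov (fun y => cov Z y (X y)) x (Y x)
    - cov Z x (VectorField.mlieBracket 𝓘(ℝ, E) X Y x)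

end Manifold

/-! ## Lie groups with left-invariant metric -/

section LieGroup

variable {E : Type*} [NormedAddCommGroup E] [NormedSpace ℝ E]
  {D : Type*} [TopologicalSpace D] [ChartedSpace E D] [Group D] [LieGroup 𝓘(ℝ, E) ∞ D]

instance lieGroup_minSmoothness : LieGroup 𝓘(ℝ, E) (minSmoothness ℝ 3) D := by
  rw [minSmoothness_of_isRCLikeNormedField]
  infer_instance

lemma leftTriv_aux (p q : D) (v : TangentSpace 𝓘(ℝ, E) q) :
    (mfderiv 𝓘(ℝ, E) 𝓘(ℝ, E) (fun y : D => p * y) (p⁻¹ * q) : E →L[ℝ] E)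
      ((mfderiv 𝓘(ℝ, E) 𝓘(ℝ, E) (fun y : D => p⁻¹ * y) q : E →L[ℝ] E) v) = v := by
  have hd : ∀ a b : D, MDifferentiableAt 𝓘(ℝ, E) 𝓘(ℝ, E) (fun y : D => a * y) b := fun a b =>
    (contMDiff_mul_left (I := 𝓘(ℝ, E)) (n := ∞) (a := a)).contMDiffAt.mdifferentiableAt (by simp)
  have h := mfderiv_comp q (hd p (p⁻¹ * q)) (hd p⁻¹ q)
  have hid : (fun y : D => p * y) ∘ (fun y : D => p⁻¹ * y) = id := by
    ext y
    simp
  rw [hid, mfderiv_id] at h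
  exact (congrArg (fun A : E →L[ℝ] E => A v) h).symm

/-- The isomorphism of the tangent space at `p` with the Lie algebra given by left translation.
Its inverse sends `v` to the value at `p` of the left-invariant field of `v`. -/
def leftTriv (p : D) : TangentSpace 𝓘(ℝ, E) p ≃ₗ[ℝ] GroupLieAlgebra 𝓘(ℝ, E) D where
  toFun v := (mfderiv 𝓘(ℝ, E) 𝓘(ℝ, E) (fun y : D => p⁻¹ * y) p : E →L[ℝ] E) v
  map_add' := map_add (mfderiv 𝓘(ℝ, E) 𝓘(ℝ, E) (fun y : D => p⁻¹ * y) p)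
  map_smul' := map_smul (mfderiv 𝓘(ℝ, E) 𝓘(ℝ, E) (fun y : D => p⁻¹ * y) p)
  invFun v := mulInvariantVectorField v p
  left_inv v := by
    have h := leftTriv_aux p p v
    rw [inv_mul_cancel] at h
    exact h
  right_inv v := by
    have h := leftTriv_aux p⁻¹ 1 v
    rw [inv_inv, mul_one] at h
    exact h

lemma mulInvariantVectorField_leftTriv (p : D) (v : TangentSpace 𝓘(ℝ, E) p) :
    mulInvariantVectorField (leftTriv p v) p = v :=
  (leftTriv p).left_inv v

variable [FiniteDimensional ℝ E]

/-- The left-invariant metric on `D` that is given at the identity by `B`, under an identification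
`φ` of the Lie algebra of `D` with `𝔩`. (As `B` is ad-invariant, this metric is bi-invariant when
`D` is connected.) -/
def invariantMetric {𝔩 : Type*} [LieRing 𝔩] [LieAlgebra ℝ 𝔩]
    (φ : GroupLieAlgebra 𝓘(ℝ, E) D ≃ₗ⁅ℝ⁆ 𝔩) (B : InvariantScalarProduct 𝔩) (p : D) :
    LinearMap.BilinForm ℝ (TangentSpace 𝓘(ℝ, E) p) :=
  LinearMap.BilinForm.congr ((leftTriv p).trans φ.toLinearEquiv).symm B.form

lemma invariantMetric_apply {𝔩 : Type*} [LieRing 𝔩] [LieAlgebra ℝ 𝔩]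
    (φ : GroupLieAlgebra 𝓘(ℝ, E) D ≃ₗ⁅ℝ⁆ 𝔩) (B : InvariantScalarProduct 𝔩) (p : D)
    (v w : TangentSpace 𝓘(ℝ, E) p) :
    invariantMetric φ B p v w = B.form (φ (leftTriv p v)) (φ (leftTriv p w)) :=
  rfl

lemma invariantMetric_nondegenerate {𝔩 : Type*} [LieRing 𝔩] [LieAlgebra ℝ 𝔩]
    (φ : GroupLieAlgebra 𝓘(ℝ, E) D ≃ₗ⁅ℝ⁆ 𝔩) (B : InvariantScalarProduct 𝔩) (p : D) :
    (invariantMetric φ B p).Nondegenerate :=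
  B.nondegenerate.congr _

/-- The left-invariant vector field on `D` that belongs to `x`, under an identification `φ` of the
Lie algebra of `D` with `𝔩`. -/
def invariantField {𝔩 : Type*} [LieRing 𝔩] [LieAlgebra ℝ 𝔩]
    (φ : GroupLieAlgebra 𝓘(ℝ, E) D ≃ₗ⁅ℝ⁆ 𝔩) (x : 𝔩) (p : D) : TangentSpace 𝓘(ℝ, E) p :=
  mulInvariantVectorField (φ.symm x) p

instance tangentSpace_finiteDimensional (p : D) :
    FiniteDimensional ℝ (TangentSpace 𝓘(ℝ, E) p) :=
  inferInstanceAs (FiniteDimensional ℝ E)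

lemma mdifferentiableAt_invariant (v : GroupLieAlgebra 𝓘(ℝ, E) D) (p : D) :
    MDiffAt (T% (mulInvariantVectorField (I := 𝓘(ℝ, E)) v : Π p : D, TangentSpace 𝓘(ℝ, E) p)) p :=
  mdifferentiableAt_mulInvariantVectorField v

variable (cov : CovariantDerivative 𝓘(ℝ, E) E (TangentSpace 𝓘(ℝ, E) : D → Type _))

/-- The covariant derivative of the left-invariant field of `w` along that of `v`. -/
def covInvariant (v w : GroupLieAlgebra 𝓘(ℝ, E) D) (p : D) : TangentSpace 𝓘(ℝ, E) p :=
  cov (mulInvariantVectorField w) p (mulInvariantVectorField v p)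

lemma covInvariant_add_left (v v' w : GroupLieAlgebra 𝓘(ℝ, E) D) :
    covInvariant cov (v + v') w = covInvariant cov v w + covInvariant cov v' w := by
  ext p
  simp [covInvariant, mulInvariantVectorField_add]

lemma covInvariant_smul_left (c : ℝ) (v w : GroupLieAlgebra 𝓘(ℝ, E) D) :
    covInvariant cov (c • v) w = c • covInvariant cov v w := by
  ext p
  simp [covInvariant, mulInvariantVectorField_smul]

lemma covInvariant_add_right (v w w' : GroupLieAlgebra 𝓘(ℝ, E) D) :
    covInvariant cov v (w + w') = covInvariant cov v w + covInvariant cov v w' := by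
  ext p
  simp [covInvariant, mulInvariantVectorField_add, cov.isCovariantDerivativeOn.add
    (mdifferentiableAt_invariant w p) (mdifferentiableAt_invariant w' p) (Set.mem_univ p)]

lemma covInvariant_smul_right (c : ℝ) (v w : GroupLieAlgebra 𝓘(ℝ, E) D) :
    covInvariant cov v (c • w) = c • covInvariant cov v w := by
  ext p
  simp [covInvariant, mulInvariantVectorField_smul, cov.isCovariantDerivativeOn.smul_const c
    (mdifferentiableAt_invariant w p) (Set.mem_univ p)]

lemma curvatureField_invariant (u v w : GroupLieAlgebra 𝓘(ℝ, E) D) (p : D) :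
    curvatureField cov (mulInvariantVectorField u) (mulInvariantVectorField v)
        (mulInvariantVectorField w) p =
      cov (covInvariant cov v w) p (mulInvariantVectorField u p)
        - cov (covInvariant cov u w) p (mulInvariantVectorField v p)
        - covInvariant cov ⁅u, v⁆ w p := by
  unfold curvatureField
  rw [← mulInvariantVector_mlieBracket]
  rfl

variable [cov.ContMDiffCovariantDerivative 1]

lemma mdifferentiableAt_cov_invariant (v w : GroupLieAlgebra 𝓘(ℝ, E) D) (p : D) :
    MDiffAt (T% (fun y : D => cov (mulInvariantVectorField w) y (mulInvariantVectorField v y)))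
      p := by
  have hs : minSmoothness ℝ 2 = 1 + 1 := by
    rw [minSmoothness_of_isRCLikeNormedField]; norm_num
  have hw := contMDiff_mulInvariantVectorField (I := 𝓘(ℝ, E)) (G := D) w
  have hv := contMDiff_mulInvariantVectorField (I := 𝓘(ℝ, E)) (G := D) v
  rw [hs] at hw hv
  have h := (CovariantDerivative.ContMDiffCovariantDerivative.contMDiff (cov := cov)
    (k := 1)).contMDiff (σ := mulInvariantVectorField w) hw.contMDiffOn
  have h' := (h p trivial).contMDiffAt Filter.univ_mem
  exact (h'.clm_bundle_apply ((hv p).of_le (by norm_num))).mdifferentiableAt (by simp)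

lemma cov_covInvariant_add (v w v' w' : GroupLieAlgebra 𝓘(ℝ, E) D) (p : D) :
    cov (covInvariant cov v w + covInvariant cov v' w') p =
      cov (covInvariant cov v w) p + cov (covInvariant cov v' w') p :=
  cov.isCovariantDerivativeOn.add (mdifferentiableAt_cov_invariant cov v w p)
    (mdifferentiableAt_cov_invariant cov v' w' p) (Set.mem_univ p)

lemma cov_covInvariant_smul (c : ℝ) (v w : GroupLieAlgebra 𝓘(ℝ, E) D) (p : D) :
    cov (c • covInvariant cov v w) p = c • cov (covInvariant cov v w) p :=
  cov.isCovariantDerivativeOn.smul_const c (mdifferentiableAt_cov_invariant cov v w p)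
    (Set.mem_univ p)

/-- The curvature tensor of `∇` on the tangent space at `p`. As curvature is tensorial, tangent
vectors may be extended to left-invariant vector fields in order to evaluate it. -/
def curvatureTensor (p : D) : TangentSpace 𝓘(ℝ, E) p →ₗ[ℝ] TangentSpace 𝓘(ℝ, E) p →ₗ[ℝ]
    Module.End ℝ (TangentSpace 𝓘(ℝ, E) p) :=
  LinearMap.mk₂ ℝ
    (fun u v =>
      { toFun := fun w => curvatureField cov (mulInvariantVectorField (leftTriv p u))
          (mulInvariantVectorField (leftTriv p v)) (mulInvariantVectorField (leftTriv p w)) p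
        map_add' := fun w w' => by
          simp only [curvatureField_invariant, map_add, covInvariant_add_right,
            cov_covInvariant_add, add_apply, Pi.add_apply]
          abel
        map_smul' := fun c w => by
          simp only [curvatureField_invariant, map_smul, covInvariant_smul_right,
            cov_covInvariant_smul, smul_apply, Pi.smul_apply, smul_sub,
            RingHom.id_apply] })
    (fun u u' v => by
      ext w
      simp only [LinearMap.coe_mk, AddHom.coe_mk, LinearMap.add_apply,
        curvatureField_invariant, map_add]
      simp only [covInvariant_add_left, cov_covInvariant_add, add_apply,
        Pi.add_apply, add_lie, mulInvariantVectorField_add, map_add]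
      abel)
    (fun c u v => by
      ext w
      simp only [LinearMap.coe_mk, AddHom.coe_mk, LinearMap.smul_apply,
        curvatureField_invariant, map_smul]
      simp only [covInvariant_smul_left, cov_covInvariant_smul, smul_apply,
        Pi.smul_apply, smul_lie, mulInvariantVectorField_smul, map_smul,
        smul_sub])
    (fun u v v' => by
      ext w
      simp only [LinearMap.coe_mk, AddHom.coe_mk, LinearMap.add_apply,
        curvatureField_invariant, map_add]
      simp only [covInvariant_add_left, cov_covInvariant_add, add_apply,
        Pi.add_apply, lie_add, mulInvariantVectorField_add, map_add]
      abel)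
    (fun c u v => by
      ext w
      simp only [LinearMap.coe_mk, AddHom.coe_mk, LinearMap.smul_apply,
        curvatureField_invariant, map_smul]
      simp only [covInvariant_smul_left, cov_covInvariant_smul, smul_apply,
        Pi.smul_apply, lie_smul, mulInvariantVectorField_smul, map_smul,
        smul_sub])

/-- The Ricci tensor `Ric(v, w) = tr (u ↦ R(u, v) w)` at `p`. -/
def ricciTensor (p : D) : LinearMap.BilinForm ℝ (TangentSpace 𝓘(ℝ, E) p) :=
  LinearMap.mk₂ ℝ
    (fun v w => LinearMap.trace ℝ (TangentSpace 𝓘(ℝ, E) p)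
      { toFun := fun u => curvatureTensor cov p u v w
        map_add' := fun u u' => by simp
        map_smul' := fun c u => by simp })
    (fun v v' w => by
      rw [← map_add]
      congr 1
      ext u
      simp)
    (fun c v w => by
      rw [← map_smul]
      congr 1
      ext u
      simp)
    (fun v w w' => by
      rw [← map_add]
      congr 1
      ext u
      simp)
    (fun c v w => by
      rw [← map_smul]
      congr 1
      ext u
      simp)

section Metric

variable {𝔩 : Type*} [LieRing 𝔩] [LieAlgebra ℝ 𝔩]
  (φ : GroupLieAlgebra 𝓘(ℝ, E) D ≃ₗ⁅ℝ⁆ 𝔩) (B : InvariantScalarProduct 𝔩)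

/-- The Ricci tensor at `p`, regarded by means of the metric as an endomorphism. -/
def ricciOperator (p : D) : Module.End ℝ (TangentSpace 𝓘(ℝ, E) p) :=
  raiseIndex (invariantMetric φ B p) (invariantMetric_nondegenerate φ B p) (ricciTensor cov p)

/-- The scalar curvature at `p`. -/
def scalarCurvature (p : D) : ℝ :=
  metricTrace (invariantMetric φ B p) (invariantMetric_nondegenerate φ B p) (ricciTensor cov p)

/-- The Ricci tensor is 2-step nilpotent: as an endomorphism it satisfies `Ric ∘ Ric = 0`. -/
def IsRicciTwoStepNilpotent : Prop :=
  ∀ p : D, ricciOperator cov φ B p ∘ₗ ricciOperator cov φ B p = 0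

end Metric

end LieGroup

end

/-!
The Levi-Civita connection of a left-invariant metric that comes from an ad-invariant scalar product
is given on left-invariant fields by `∇_v w = [v, w] / 2` (`covInvariant_eq_half_lie`): left-invariant
fields have constant scalar products, and the three cyclic torsion identities can be solved for `∇`
as in Koszul's formula. The Jacobi identity turns this into `R(u, v) w = -[[u, v], w] / 4`, whose
trace is `Ric = -B / 4` with `B` the Killing form (`ricciTensor_eq_killingForm`). Left translation
thus reduces every assertion about curvature to one about the Killing form of a metric Lie algebra.

The adjoint representation of the double extension `𝔥* ⊕ 𝔤 ⊕ 𝔥` is block upper triangular, with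
diagonal blocks `ad* H`, `ad X + π(H)` and `ad H`, so its Killing form is read off from the traces of
the diagonal blocks (`DoubleExtension.killingForm_apply`). This gives the Ricci tensor and the
criterion for Ricci-flatness.

For the scalar curvature and for nilpotency, let `A` be the Killing form of the double extension with
one index raised (`DoubleExtension.killingOperator`). Since `𝔥*` lies in the radical of the Killing
form, `A` vanishes on `𝔥*` and has image in `𝔥* ⊕ 𝔤 = (𝔥*)⊥`. Hence only the `𝔤`-block of `A` has a
trace. Moreover `A` is self-adjoint, so `A ∘ A = 0` means that its image is totally isotropic, and on
this image the scalar product depends on the `𝔤`-components alone. Expanding it in an orthonormal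
basis of `𝔤`, for the pairs from `𝔤 × 𝔤`, `𝔤 × 𝔥` and `𝔥 × 𝔥`, gives the three conditions.
-/

open Module
open scoped Manifold ContDiff

noncomputable section

/-! ### Raising an index -/

section RaiseIndex

variable {V : Type*} [AddCommGroup V] [Module ℝ V]

lemma eq_of_forall_apply_eq {g : LinearMap.BilinForm ℝ V} (hg : g.Nondegenerate) {v w : V}
    (h : ∀ y, g v y = g w y) : v = w :=
  sub_eq_zero.1 (hg.1 _ fun y => by rw [map_sub, LinearMap.sub_apply, h, sub_self])

lemma IsPseudoOrthonormal.apply_eq_sum {g : LinearMap.BilinForm ℝ V} (gs : g.IsSymm) {n : ℕ}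
    {b : Basis (Fin n) ℝ V} {ε : Fin n → ℝ} (hb : IsPseudoOrthonormal g b ε) (v w : V) :
    g v w = ∑ j, ε j * g v (b j) * g w (b j) := by
  have hv : ∀ j, g v (b j) = ε j * b.repr v j := fun j => by
    conv_lhs => rw [← b.sum_repr v]
    rw [map_sum, LinearMap.sum_apply, Finset.sum_eq_single j]
    · rw [map_smul, LinearMap.smul_apply, hb.self, smul_eq_mul, mul_comm]
    · intro i _ hij
      rw [map_smul, LinearMap.smul_apply, hb.orthogonal i j hij, smul_zero]
    · simp
  conv_lhs => rw [← b.sum_repr v]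
  rw [map_sum, LinearMap.sum_apply]
  refine Finset.sum_congr rfl fun j _ => ?_
  rw [hv, map_smul, LinearMap.smul_apply, smul_eq_mul, gs.eq]
  -- the sign enters as `ε j * ε j = 1`
  rcases hb.sign j with h | h <;> rw [h] <;> ring

variable [FiniteDimensional ℝ V]

lemma apply_raiseIndex (g : LinearMap.BilinForm ℝ V) (hg : g.Nondegenerate)
    (T : LinearMap.BilinForm ℝ V) (v w : V) : g (raiseIndex g hg T v) w = T v w :=
  LinearMap.BilinForm.symmCompOfNondegenerate_left_apply _ _ _ _

/-- For a symmetric tensor `T`, the endomorphism `A` with `g (A v) w = T v w` is self-adjoint, so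
`A ∘ A = 0` means that the image of `A` is totally isotropic. -/
lemma raiseIndex_comp_self_eq_zero_iff {g : LinearMap.BilinForm ℝ V} (hg : g.Nondegenerate)
    (gs : g.IsSymm) {T : LinearMap.BilinForm ℝ V} (hT : T.IsSymm) :
    raiseIndex g hg T ∘ₗ raiseIndex g hg T = 0 ↔
      ∀ v w, g (raiseIndex g hg T v) (raiseIndex g hg T w) = 0 := by
  have h : ∀ v w, g (raiseIndex g hg T v) (raiseIndex g hg T w) =
      g ((raiseIndex g hg T ∘ₗ raiseIndex g hg T) v) w := fun v w => by
    rw [LinearMap.comp_apply, apply_raiseIndex g hg T (raiseIndex g hg T v), hT.eq,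
      ← apply_raiseIndex g hg T w, gs.eq]
  refine ⟨fun h0 v w => by rw [h, h0]; simp, fun h0 => ?_⟩
  ext v
  exact eq_of_forall_apply_eq hg fun w => by rw [← h, h0]; simp

end RaiseIndex

/-! ### Curvature of a Lie group with ad-invariant scalar product -/

section Curvature

variable {E : Type*} [NormedAddCommGroup E] [NormedSpace ℝ E]
  {D : Type*} [TopologicalSpace D] [ChartedSpace E D] [Group D] [LieGroup 𝓘(ℝ, E) ∞ D]

lemma leftTriv_mulInvariantVectorField (p : D) (v : GroupLieAlgebra 𝓘(ℝ, E) D) :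
    leftTriv p (mulInvariantVectorField v p) = v :=
  (leftTriv p).right_inv v

variable [FiniteDimensional ℝ E]
  {𝔩 : Type*} [LieRing 𝔩] [LieAlgebra ℝ 𝔩]
  {φ : GroupLieAlgebra 𝓘(ℝ, E) D ≃ₗ⁅ℝ⁆ 𝔩} {B : InvariantScalarProduct 𝔩}
  {cov : CovariantDerivative 𝓘(ℝ, E) E (TangentSpace 𝓘(ℝ, E) : D → Type _)}

/-- Vanishing torsion, evaluated on left-invariant fields. -/
lemma covInvariant_sub_swap (h : IsLeviCivita (invariantMetric φ B) cov)
    (v w : GroupLieAlgebra 𝓘(ℝ, E) D) (p : D) :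
    covInvariant cov v w p - covInvariant cov w v p = mulInvariantVectorField ⁅v, w⁆ p := by
  rw [GroupLieAlgebra.bracket_def, mulInvariantVector_mlieBracket]
  exact (cov.torsion_eq_zero_iff.1 h.torsion_eq_zero) (mdifferentiableAt_invariant v p)
    (mdifferentiableAt_invariant w p)

/-- Left-invariant fields have constant scalar products, so compatibility with the metric says that
`∇_u` acts on them by a skew map. -/
lemma invariantMetric_covInvariant (h : IsLeviCivita (invariantMetric φ B) cov)
    (u v w : GroupLieAlgebra 𝓘(ℝ, E) D) (p : D) :
    invariantMetric φ B p (covInvariant cov u v p) (mulInvariantVectorField w p) =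
      -invariantMetric φ B p (covInvariant cov u w p) (mulInvariantVectorField v p) := by
  have hm := h.metric (mulInvariantVectorField v) (mulInvariantVectorField w) p
    (mdifferentiableAt_invariant v p) (mdifferentiableAt_invariant w p)
    (mulInvariantVectorField u p)
  have hc : (fun y : D => invariantMetric φ B y (mulInvariantVectorField v y)
      (mulInvariantVectorField w y)) = fun _ => B.form (φ v) (φ w) := by
    funext y
    rw [invariantMetric_apply, leftTriv_mulInvariantVectorField, leftTriv_mulInvariantVectorField]
  rw [hc, mvfderiv_const] at hm
  have hs : invariantMetric φ B p (mulInvariantVectorField v p) (covInvariant cov u w p) =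
      invariantMetric φ B p (covInvariant cov u w p) (mulInvariantVectorField v p) := by
    rw [invariantMetric_apply, invariantMetric_apply, B.symm.eq]
  rw [← hs]
  unfold covInvariant
  exact eq_neg_of_add_eq_zero_left hm.symm

/-- The Levi-Civita connection of an ad-invariant scalar product is `∇_v w = [v, w] / 2` on
left-invariant fields. -/
lemma covInvariant_eq_half_lie (h : IsLeviCivita (invariantMetric φ B) cov)
    (v w : GroupLieAlgebra 𝓘(ℝ, E) D) :
    covInvariant cov v w = (1 / 2 : ℝ) • mulInvariantVectorField ⁅v, w⁆ := by
  funext p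
  set T := fun a b c : GroupLieAlgebra 𝓘(ℝ, E) D =>
    B.form (φ (leftTriv p (covInvariant cov a b p))) (φ c) with hT
  have hskew : ∀ a b c, T a b c = -T a c b := fun a b c => by
    have := invariantMetric_covInvariant h a b c p
    rwa [invariantMetric_apply, invariantMetric_apply, leftTriv_mulInvariantVectorField,
      leftTriv_mulInvariantVectorField] at this
  have htor : ∀ a b c, T a b c - T b a c = B.form ⁅φ a, φ b⁆ (φ c) := fun a b c => by
    have := congrArg (fun x => B.form (φ (leftTriv p x)) (φ c)) (covInvariant_sub_swap h a b p)
    simpa only [map_sub, LinearMap.sub_apply, leftTriv_mulInvariantVectorField, LieEquiv.map_lie]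
      using this
  -- Koszul's formula: combine the torsion identity for the three pairs of arguments, skewness of
  -- `T` in its last two arguments and total antisymmetry of `B([·, ·], ·)`.
  have key : ∀ c, T v w c = (1 / 2) * B.form ⁅φ v, φ w⁆ (φ c) := fun c => by
    have e₁ := htor v w c
    have e₂ := htor v c w
    have e₃ := htor w c v
    have s₁ := hskew v w c
    have s₂ := hskew w v c
    have s₃ := hskew c v w
    have i₁ : B.form ⁅φ v, φ c⁆ (φ w) = -B.form ⁅φ v, φ w⁆ (φ c) := by
      rw [B.invariant, B.symm.eq]
    have i₂ : B.form ⁅φ w, φ c⁆ (φ v) = B.form ⁅φ v, φ w⁆ (φ c) := by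
      rw [B.invariant, B.symm.eq, ← lie_skew, map_neg, LinearMap.neg_apply, neg_neg]
    linarith
  refine ((leftTriv p).trans φ.toLinearEquiv).injective ?_
  change φ (leftTriv p (covInvariant cov v w p)) = φ (leftTriv p _)
  refine sub_eq_zero.1 (B.nondegenerate.1 _ fun y => ?_)
  have := key (φ.symm y)
  simp only [hT, LieEquiv.apply_symm_apply] at this
  rw [map_sub, LinearMap.sub_apply, this, Pi.smul_apply, map_smul, map_smul, map_smul,
    leftTriv_mulInvariantVectorField, LieEquiv.map_lie, LinearMap.smul_apply, smul_eq_mul, sub_self]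

variable [cov.ContMDiffCovariantDerivative 1]

/-- The curvature is `R(u, v) w = -[[u, v], w] / 4`, by the Jacobi identity. -/
lemma leftTriv_curvatureTensor (h : IsLeviCivita (invariantMetric φ B) cov) (p : D)
    (u v w : TangentSpace 𝓘(ℝ, E) p) :
    leftTriv p (curvatureTensor cov p u v w) =
      (-(1 / 4) : ℝ) • ⁅⁅leftTriv p u, leftTriv p v⁆, leftTriv p w⁆ := by
  have hcov : ∀ (a b c : GroupLieAlgebra 𝓘(ℝ, E) D), leftTriv p
      (cov (covInvariant cov b c) p (mulInvariantVectorField a p)) =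
        (1 / 4 : ℝ) • ⁅a, ⁅b, c⁆⁆ := fun a b c => by
    rw [covInvariant_eq_half_lie h, cov.isCovariantDerivativeOn.smul_const _
      (mdifferentiableAt_invariant _ p) (Set.mem_univ p)]
    -- `∇_b c` is again left-invariant, so the formula for `∇` applies a second time
    change leftTriv p ((1 / 2 : ℝ) • covInvariant cov a ⁅b, c⁆ p) = _
    rw [covInvariant_eq_half_lie h, Pi.smul_apply, map_smul, map_smul,
      leftTriv_mulInvariantVectorField, smul_smul]
    norm_num
  change leftTriv p (curvatureField cov (mulInvariantVectorField (leftTriv p u))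
          (mulInvariantVectorField (leftTriv p v)) (mulInvariantVectorField (leftTriv p w)) p) = _
  rw [curvatureField_invariant, map_sub, map_sub, hcov, hcov, covInvariant_eq_half_lie h,
    Pi.smul_apply, map_smul, leftTriv_mulInvariantVectorField, lie_lie]
  module

variable [FiniteDimensional ℝ 𝔩]

/-- `Ric = -B_𝔩 / 4`: the map `u ↦ R(u, v) w` corresponds to `-(ad w ∘ ad v) / 4`. -/
theorem ricciTensor_eq_killingForm (h : IsLeviCivita (invariantMetric φ B) cov) (p : D)
    (v w : TangentSpace 𝓘(ℝ, E) p) :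
    ricciTensor cov p v w =
      -(1 / 4) * killingForm ℝ 𝔩 (φ (leftTriv p v)) (φ (leftTriv p w)) := by
  set L := (leftTriv p).trans φ.toLinearEquiv
  have hconj : L.conj { toFun := fun u => curvatureTensor cov p u v w
                        map_add' := fun u u' => by simp
                        map_smul' := fun c u => by simp } =
      (-(1 / 4) : ℝ) • (LieAlgebra.ad ℝ 𝔩 (L w) ∘ₗ LieAlgebra.ad ℝ 𝔩 (L v)) := by
    ext x
    rw [LinearEquiv.conj_apply_apply]
    change φ (leftTriv p (curvatureTensor cov p (L.symm x) v w)) = _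
    rw [leftTriv_curvatureTensor h, map_smul, LieEquiv.map_lie, LieEquiv.map_lie]
    change _ • ⁅⁅L (L.symm x), L v⁆, L w⁆ = (-(1 / 4) : ℝ) • ⁅L w, ⁅L v, x⁆⁆
    rw [L.apply_symm_apply, ← lie_skew, ← lie_skew x, lie_neg, neg_neg]
  change LinearMap.trace ℝ (TangentSpace 𝓘(ℝ, E) p) _ = _
  rw [← LinearMap.trace_conj' _ L, hconj, map_smul, smul_eq_mul, LinearMap.trace_comp_comm',
    killingForm_apply_apply]
  rfl

lemma ricciTensor_invariantField (h : IsLeviCivita (invariantMetric φ B) cov) (p : D) (x y : 𝔩) :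
    ricciTensor cov p (invariantField φ x p) (invariantField φ y p) =
      -(1 / 4) * killingForm ℝ 𝔩 x y := by
  rw [ricciTensor_eq_killingForm h]
  simp only [invariantField, leftTriv_mulInvariantVectorField, LieEquiv.apply_symm_apply]

/-- Left translation carries the Ricci operator at every point to the same endomorphism of the Lie
algebra. -/
lemma conj_ricciOperator (h : IsLeviCivita (invariantMetric φ B) cov) (p : D) :
    ((leftTriv p).trans φ.toLinearEquiv).conj (ricciOperator cov φ B p) =
      (-(1 / 4) : ℝ) • raiseIndex B.form B.nondegenerate (killingForm ℝ 𝔩) := by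
  ext x
  refine eq_of_forall_apply_eq B.nondegenerate fun y => ?_
  rw [LinearMap.smul_apply, map_smul, LinearMap.smul_apply, apply_raiseIndex, smul_eq_mul,
    ← ricciTensor_invariantField h p, LinearEquiv.conj_apply_apply,
    ← apply_raiseIndex (invariantMetric φ B p) (invariantMetric_nondegenerate φ B p),
    invariantMetric_apply]
  simp only [invariantField, leftTriv_mulInvariantVectorField, LieEquiv.apply_symm_apply]
  rfl

theorem scalarCurvature_eq (h : IsLeviCivita (invariantMetric φ B) cov) (p : D) :
    scalarCurvature cov φ B p =
      -(1 / 4) * metricTrace B.form B.nondegenerate (killingForm ℝ 𝔩) := by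
  change LinearMap.trace ℝ _ (ricciOperator cov φ B p) = -(1 / 4) * LinearMap.trace ℝ 𝔩 _
  rw [← LinearMap.trace_conj' _ ((leftTriv p).trans φ.toLinearEquiv), conj_ricciOperator h,
    map_smul, smul_eq_mul]

/-- As `Ric` is a nonzero multiple of the Killing form, it is 2-step nilpotent if and only if the
endomorphism given by the Killing form has totally isotropic image. -/
theorem isRicciTwoStepNilpotent_iff (h : IsLeviCivita (invariantMetric φ B) cov) :
    IsRicciTwoStepNilpotent cov φ B ↔
      ∀ x y, B.form (raiseIndex B.form B.nondegenerate (killingForm ℝ 𝔩) x)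
        (raiseIndex B.form B.nondegenerate (killingForm ℝ 𝔩) y) = 0 := by
  rw [← raiseIndex_comp_self_eq_zero_iff B.nondegenerate B.symm
    ⟨fun x y => LieModule.traceForm_comm ℝ 𝔩 𝔩 x y⟩]
  have key : ∀ p : D, ricciOperator cov φ B p ∘ₗ ricciOperator cov φ B p = 0 ↔
      raiseIndex B.form B.nondegenerate (killingForm ℝ 𝔩) ∘ₗ
        raiseIndex B.form B.nondegenerate (killingForm ℝ 𝔩) = 0 := fun p => by
    rw [← ((leftTriv p).trans φ.toLinearEquiv).conj.map_eq_zero_iff, LinearEquiv.conj_comp,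
      conj_ricciOperator h, LinearMap.smul_comp, LinearMap.comp_smul, smul_smul, smul_eq_zero]
    norm_num
  exact ⟨fun h0 => (key 1).1 (h0 1), fun h0 p => (key p).2 h0⟩

theorem ricciTensor_eq_zero_iff (h : IsLeviCivita (invariantMetric φ B) cov) :
    (∀ p : D, ricciTensor cov p = 0) ↔ killingForm ℝ 𝔩 = 0 := by
  constructor
  · intro h0
    ext x y
    have := ricciTensor_invariantField h 1 x y
    rw [h0] at this
    simpa using this
  · intro h0 p
    ext v w
    rw [ricciTensor_eq_killingForm h, h0]
    simp

end Curvature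

/-! ### The Killing form of a double extension -/

section KillingForm

variable {𝔤 𝔥 : Type*} [LieRing 𝔤] [LieAlgebra ℝ 𝔤] [LieRing 𝔥] [LieAlgebra ℝ 𝔥]
  {B : InvariantScalarProduct 𝔤} {π : 𝔥 →ₗ⁅ℝ⁆ skewDerivations B}

namespace DoubleExtension

/-- The inclusion of `𝔥*`, as a linear map. -/
def inDualₗ : Dual ℝ 𝔥 →ₗ[ℝ] DoubleExtension π where
  toFun := inDual
  map_add' α α' := by ext <;> simp [inDual]
  map_smul' c α := by ext <;> simp [inDual]

/-- The inclusion of `𝔤`, as a linear map. -/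
def inMidₗ : 𝔤 →ₗ[ℝ] DoubleExtension π where
  toFun := inMid
  map_add' X X' := by ext <;> simp [inMid]
  map_smul' c X := by ext <;> simp [inMid]

/-- The inclusion of `𝔥`, as a linear map. -/
def inTopₗ : 𝔥 →ₗ[ℝ] DoubleExtension π where
  toFun := inTop
  map_add' H H' := by ext <;> simp [inTop]
  map_smul' c H := by ext <;> simp [inTop]

/-- The projection to `𝔥*`, as a linear map. -/
def dualₗ : DoubleExtension π →ₗ[ℝ] Dual ℝ 𝔥 where
  toFun := dual
  map_add' _ _ := rfl
  map_smul' _ _ := rfl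

/-- The projection to `𝔤`, as a linear map. -/
def midₗ : DoubleExtension π →ₗ[ℝ] 𝔤 where
  toFun := mid
  map_add' _ _ := rfl
  map_smul' _ _ := rfl

/-- The projection to `𝔥`, as a linear map. -/
def topₗ : DoubleExtension π →ₗ[ℝ] 𝔥 where
  toFun := top
  map_add' _ _ := rfl
  map_smul' _ _ := rfl

lemma eq_inDual_add_inMid_add_inTop (x : DoubleExtension π) :
    x = inDual x.dual + inMid x.mid + inTop x.top := by
  ext <;> simp [inDual, inMid, inTop]

lemma scalarProduct_apply {Bh : InvariantForm 𝔥} (x y : DoubleExtension π) :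
    (scalarProduct π Bh).form x y =
      Bh.form x.top y.top + B.form x.mid y.mid + x.dual y.top + y.dual x.top :=
  rfl

variable [FiniteDimensional ℝ 𝔤] [FiniteDimensional ℝ 𝔥]

instance : FiniteDimensional ℝ (DoubleExtension π) :=
  Module.Finite.of_surjective (LinearMap.coprod inDualₗ (LinearMap.coprod inMidₗ inTopₗ))
    fun x => ⟨(x.dual, x.mid, x.top), by
      rw [eq_inDual_add_inMid_add_inTop x, add_assoc]
      simp [inDual, inMid, inTop, inDualₗ, inMidₗ, inTopₗ]⟩

/-- The trace of an endomorphism of `𝔥* ⊕ 𝔤 ⊕ 𝔥` is the sum of the traces of its three diagonal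
blocks. -/
lemma trace_eq_trace_blocks (f : Module.End ℝ (DoubleExtension π)) :
    LinearMap.trace ℝ _ f =
      LinearMap.trace ℝ (Dual ℝ 𝔥) (dualₗ ∘ₗ f ∘ₗ inDualₗ) +
        LinearMap.trace ℝ 𝔤 (midₗ ∘ₗ f ∘ₗ inMidₗ) + LinearMap.trace ℝ 𝔥 (topₗ ∘ₗ f ∘ₗ inTopₗ) := by
  have h : f = f ∘ₗ inDualₗ ∘ₗ dualₗ + f ∘ₗ inMidₗ ∘ₗ midₗ + f ∘ₗ inTopₗ ∘ₗ topₗ := by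
    ext1 x
    conv_lhs => rw [eq_inDual_add_inMid_add_inTop x, map_add, map_add]
    rfl
  conv_lhs => rw [h]
  simp only [map_add, ← LinearMap.comp_assoc]
  rw [LinearMap.trace_comp_comm' dualₗ, LinearMap.trace_comp_comm' midₗ,
    LinearMap.trace_comp_comm' topₗ]
  simp only [LinearMap.comp_assoc]

/-- The Killing form of the double extension. The endomorphism `ad (α, X, H)` is block upper
triangular with diagonal blocks `ad* H`, `ad X + π(H)` and `ad H`, the first of which is the negative
transpose of the last; this is why `2 B_𝔥` appears. -/
theorem killingForm_apply (x y : DoubleExtension π) :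
    killingForm ℝ (DoubleExtension π) x y =
      killingForm ℝ 𝔤 x.mid y.mid +
        LinearMap.trace ℝ 𝔤 (LieAlgebra.ad ℝ 𝔤 x.mid ∘ₗ skewAction π y.top) +
        LinearMap.trace ℝ 𝔤 (LieAlgebra.ad ℝ 𝔤 y.mid ∘ₗ skewAction π x.top) +
        (LinearMap.trace ℝ 𝔤 (skewAction π x.top ∘ₗ skewAction π y.top) +
          2 * killingForm ℝ 𝔥 x.top y.top) := by
  have hd : dualₗ ∘ₗ (LieAlgebra.ad ℝ (DoubleExtension π) x ∘ₗ LieAlgebra.ad ℝ _ y) ∘ₗ inDualₗ =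
      Dual.transpose (R := ℝ) (LieAlgebra.ad ℝ 𝔥 y.top ∘ₗ LieAlgebra.ad ℝ 𝔥 x.top) := by
    ext α H
    change ⁅x, ⁅y, (inDual α : DoubleExtension π)⁆⁆.dual H = α ⁅y.top, ⁅x.top, H⁆⁆
    simp [lie_dual_apply, inDual]
  have hm : midₗ ∘ₗ (LieAlgebra.ad ℝ (DoubleExtension π) x ∘ₗ LieAlgebra.ad ℝ _ y) ∘ₗ inMidₗ =
      (LieAlgebra.ad ℝ 𝔤 x.mid + skewAction π x.top) ∘ₗ
        (LieAlgebra.ad ℝ 𝔤 y.mid + skewAction π y.top) := by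
    ext X
    change ⁅x, ⁅y, (inMid X : DoubleExtension π)⁆⁆.mid = _
    simp [inMid]
  have ht : topₗ ∘ₗ (LieAlgebra.ad ℝ (DoubleExtension π) x ∘ₗ LieAlgebra.ad ℝ _ y) ∘ₗ inTopₗ =
      LieAlgebra.ad ℝ 𝔥 x.top ∘ₗ LieAlgebra.ad ℝ 𝔥 y.top :=
    rfl
  rw [killingForm_apply_apply, trace_eq_trace_blocks, hd, hm, ht, LinearMap.trace_transpose',
    ← killingForm_apply_apply, ← killingForm_apply_apply, LieModule.traceForm_comm ℝ 𝔥 𝔥 y.top]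
  simp only [LinearMap.add_comp, LinearMap.comp_add, map_add]
  rw [← killingForm_apply_apply, LinearMap.trace_comp_comm' (skewAction π x.top)
    (LieAlgebra.ad ℝ 𝔤 y.mid)]
  ring

variable {Bh : InvariantForm 𝔥}

lemma killingForm_inDual (x : DoubleExtension π) (α : Dual ℝ 𝔥) :
    killingForm ℝ (DoubleExtension π) x (inDual α) = 0 := by
  simp [killingForm_apply, inDual]

lemma killingForm_inMid_inMid (X Y : 𝔤) :
    killingForm ℝ (DoubleExtension π) (inMid X) (inMid Y) = killingForm ℝ 𝔤 X Y := by
  simp [killingForm_apply, inMid]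

lemma killingForm_inTop_inMid (H : 𝔥) (Y : 𝔤) :
    killingForm ℝ (DoubleExtension π) (inTop H) (inMid Y) =
      LinearMap.trace ℝ 𝔤 (LieAlgebra.ad ℝ 𝔤 Y ∘ₗ skewAction π H) := by
  simp [killingForm_apply, inMid, inTop]

lemma killingForm_inTop_inTop (H H' : 𝔥) :
    killingForm ℝ (DoubleExtension π) (inTop H) (inTop H') =
      LinearMap.trace ℝ 𝔤 (skewAction π H ∘ₗ skewAction π H') + 2 * killingForm ℝ 𝔥 H H' := by
  simp [killingForm_apply, inTop]

variable (π Bh) in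
/-- The Killing form of the double extension, regarded by means of its scalar product as an
endomorphism. -/
def killingOperator : Module.End ℝ (DoubleExtension π) :=
  raiseIndex (scalarProduct π Bh).form (scalarProduct π Bh).nondegenerate
    (killingForm ℝ (DoubleExtension π))

lemma scalarProduct_killingOperator (x y : DoubleExtension π) :
    (scalarProduct π Bh).form (killingOperator π Bh x) y =
      killingForm ℝ (DoubleExtension π) x y :=
  apply_raiseIndex _ _ _ _ _

/-- As `𝔥*` lies in the radical of the Killing form, the image of the operator is orthogonal to `𝔥*`,
that is, contained in `𝔥* ⊕ 𝔤`. -/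
lemma killingOperator_top (x : DoubleExtension π) : (killingOperator π Bh x).top = 0 := by
  rw [← forall_dual_apply_eq_zero_iff ℝ]
  intro α
  have h := scalarProduct_killingOperator (Bh := Bh) x (inDual α)
  rw [killingForm_inDual, scalarProduct_apply] at h
  simpa [inDual] using h

lemma killingOperator_inDual (α : Dual ℝ 𝔥) :
    killingOperator π Bh (inDual α) = 0 := by
  refine eq_of_forall_apply_eq (scalarProduct π Bh).nondegenerate fun y => ?_
  rw [scalarProduct_killingOperator, LieModule.traceForm_comm, killingForm_inDual]
  simp

lemma form_killingOperator_mid (x : DoubleExtension π) (Y : 𝔤) :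
    B.form (killingOperator π Bh x).mid Y = killingForm ℝ (DoubleExtension π) x (inMid Y) := by
  rw [← scalarProduct_killingOperator (Bh := Bh), scalarProduct_apply]
  simp [inMid]

lemma killingOperator_inMid_mid (X : 𝔤) :
    (killingOperator π Bh (inMid X)).mid =
      raiseIndex B.form B.nondegenerate (killingForm ℝ 𝔤) X :=
  eq_of_forall_apply_eq B.nondegenerate fun Y => by
    rw [form_killingOperator_mid, killingForm_inMid_inMid, apply_raiseIndex]

/-- Only the middle diagonal block of the operator contributes to its trace. -/
theorem metricTrace_killingForm :
    metricTrace (scalarProduct π Bh).form (scalarProduct π Bh).nondegenerate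
        (killingForm ℝ (DoubleExtension π)) =
      metricTrace B.form B.nondegenerate (killingForm ℝ 𝔤) := by
  have hd : dualₗ ∘ₗ killingOperator π Bh ∘ₗ inDualₗ = 0 := by
    ext1 α
    exact congrArg dual (killingOperator_inDual α)
  have hm : midₗ ∘ₗ killingOperator π Bh ∘ₗ inMidₗ =
      raiseIndex B.form B.nondegenerate (killingForm ℝ 𝔤) := by
    ext1 X
    exact killingOperator_inMid_mid X
  have ht : topₗ ∘ₗ killingOperator π Bh ∘ₗ inTopₗ = 0 := by
    ext1 H
    exact killingOperator_top (inTop H)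
  change LinearMap.trace ℝ _ (killingOperator π Bh) = _
  rw [trace_eq_trace_blocks, hd, hm, ht, map_zero, map_zero, zero_add, add_zero]
  rfl

/-- On the image of the operator the scalar product only sees the `𝔤`-components. -/
lemma scalarProduct_killingOperator_killingOperator (x y : DoubleExtension π) :
    (scalarProduct π Bh).form (killingOperator π Bh x) (killingOperator π Bh y) =
      B.form (killingOperator π Bh x).mid (killingOperator π Bh y).mid := by
  simp [scalarProduct_apply, killingOperator_top]

/-- The image of the operator is spanned by the images of `𝔤` and `𝔥`. It is totally isotropic if and
only if the scalar products of these images vanish, and the three conditions say so, the last two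
being written out in an orthonormal basis of `𝔤`. -/
theorem killingOperator_isotropic_iff {n : ℕ} {b : Basis (Fin n) ℝ 𝔤} {ε : Fin n → ℝ}
    (hb : IsPseudoOrthonormal B.form b ε) :
    (∀ x y, (scalarProduct π Bh).form (killingOperator π Bh x) (killingOperator π Bh y) = 0) ↔
      (∀ X Y, B.form (raiseIndex B.form B.nondegenerate (killingForm ℝ 𝔤) X)
        (raiseIndex B.form B.nondegenerate (killingForm ℝ 𝔤) Y) = 0) ∧
      (∀ (H : 𝔥) (X : 𝔤),
        ∑ j, ε j * killingForm ℝ 𝔤 X (b j) *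
          LinearMap.trace ℝ 𝔤 (LieAlgebra.ad ℝ 𝔤 (b j) ∘ₗ skewAction π H) = 0) ∧
      (∀ H H' : 𝔥,
        ∑ j, ε j * LinearMap.trace ℝ 𝔤 (LieAlgebra.ad ℝ 𝔤 (b j) ∘ₗ skewAction π H) *
          LinearMap.trace ℝ 𝔤 (LieAlgebra.ad ℝ 𝔤 (b j) ∘ₗ skewAction π H') = 0) := by
  have hmid : ∀ X Y : 𝔤, (scalarProduct π Bh).form (killingOperator π Bh (inMid X))
      (killingOperator π Bh (inMid Y)) =
        B.form (raiseIndex B.form B.nondegenerate (killingForm ℝ 𝔤) X)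
          (raiseIndex B.form B.nondegenerate (killingForm ℝ 𝔤) Y) := fun X Y => by
    rw [scalarProduct_killingOperator_killingOperator, killingOperator_inMid_mid,
      killingOperator_inMid_mid]
  have hmix : ∀ (X : 𝔤) (H : 𝔥), (scalarProduct π Bh).form (killingOperator π Bh (inMid X))
      (killingOperator π Bh (inTop H)) = ∑ j, ε j * killingForm ℝ 𝔤 X (b j) *
        LinearMap.trace ℝ 𝔤 (LieAlgebra.ad ℝ 𝔤 (b j) ∘ₗ skewAction π H) := fun X H => by
    rw [scalarProduct_killingOperator_killingOperator, hb.apply_eq_sum B.symm]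
    simp only [form_killingOperator_mid, killingForm_inMid_inMid, killingForm_inTop_inMid]
  have htop : ∀ H H' : 𝔥, (scalarProduct π Bh).form (killingOperator π Bh (inTop H))
      (killingOperator π Bh (inTop H')) =
        ∑ j, ε j * LinearMap.trace ℝ 𝔤 (LieAlgebra.ad ℝ 𝔤 (b j) ∘ₗ skewAction π H) *
          LinearMap.trace ℝ 𝔤 (LieAlgebra.ad ℝ 𝔤 (b j) ∘ₗ skewAction π H') := fun H H' => by
    rw [scalarProduct_killingOperator_killingOperator, hb.apply_eq_sum B.symm]
    simp only [form_killingOperator_mid, killingForm_inTop_inMid]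
  constructor
  · intro h
    exact ⟨fun X Y => by rw [← hmid, h], fun H X => by rw [← hmix, h],
      fun H H' => by rw [← htop, h]⟩
  · rintro ⟨h₁, h₂, h₃⟩ x y
    rw [eq_inDual_add_inMid_add_inTop x, eq_inDual_add_inMid_add_inTop y]
    simp only [map_add, killingOperator_inDual, zero_add, LinearMap.add_apply, hmid, hmix, htop,
      h₁, h₂, h₃, (scalarProduct π Bh).symm.eq (killingOperator π Bh (inTop _))
        (killingOperator π Bh (inMid _)), add_zero]

theorem killingForm_eq_zero_iff :
    killingForm ℝ (DoubleExtension π) = 0 ↔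
      killingForm ℝ 𝔤 = 0 ∧
      (∀ (X : 𝔤) (H : 𝔥),
        LinearMap.trace ℝ 𝔤 (LieAlgebra.ad ℝ 𝔤 X ∘ₗ skewAction π H) = 0) ∧
      (∀ H H' : 𝔥,
        LinearMap.trace ℝ 𝔤 (skewAction π H ∘ₗ skewAction π H')
          + 2 * killingForm ℝ 𝔥 H H' = 0) := by
  constructor
  · intro h
    refine ⟨?_, fun X H => ?_, fun H H' => ?_⟩
    · ext X Y
      rw [← killingForm_inMid_inMid (π := π), h]
      rfl
    · rw [← killingForm_inTop_inMid, h]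
      rfl
    · rw [← killingForm_inTop_inTop, h]
      rfl
  · rintro ⟨h₁, h₂, h₃⟩
    ext x y
    rw [killingForm_apply, h₁, h₂, h₂, h₃]
    simp

end DoubleExtension

end KillingForm

/-! ### Ricci curvature of the double extension -/

end

theorem mainTheorem10
    {𝔤 𝔥 : Type*} [LieRing 𝔤] [LieAlgebra ℝ 𝔤] [FiniteDimensional ℝ 𝔤]
    [LieRing 𝔥] [LieAlgebra ℝ 𝔥] [FiniteDimensional ℝ 𝔥]
    (Bg : InvariantScalarProduct 𝔤) (Bh : InvariantForm 𝔥)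
    (π : 𝔥 →ₗ⁅ℝ⁆ skewDerivations Bg)
    -- a Lie group `G` with Lie algebra `𝔤` and its Levi-Civita connection
    {EG : Type*} [NormedAddCommGroup EG] [NormedSpace ℝ EG] [FiniteDimensional ℝ EG]
    {G : Type*} [TopologicalSpace G] [ChartedSpace EG G] [Group G] [LieGroup 𝓘(ℝ, EG) ∞ G]
    (ψ : GroupLieAlgebra 𝓘(ℝ, EG) G ≃ₗ⁅ℝ⁆ 𝔤)
    (covG : CovariantDerivative 𝓘(ℝ, EG) EG (TangentSpace 𝓘(ℝ, EG) : G → Type _))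
    [covG.ContMDiffCovariantDerivative 1]
    (hG : IsLeviCivita (invariantMetric ψ Bg) covG)
    -- a Lie group `D` whose Lie algebra is the double extension, and its Levi-Civita connection
    {ED : Type*} [NormedAddCommGroup ED] [NormedSpace ℝ ED] [FiniteDimensional ℝ ED]
    {D : Type*} [TopologicalSpace D] [ChartedSpace ED D] [Group D] [LieGroup 𝓘(ℝ, ED) ∞ D]
    (φ : GroupLieAlgebra 𝓘(ℝ, ED) D ≃ₗ⁅ℝ⁆ DoubleExtension π)
    (covD : CovariantDerivative 𝓘(ℝ, ED) ED (TangentSpace 𝓘(ℝ, ED) : D → Type _))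
    [covD.ContMDiffCovariantDerivative 1]
    (hD : IsLeviCivita (invariantMetric φ (DoubleExtension.scalarProduct π Bh)) covD) :
    -- the Ricci tensor, evaluated on left-invariant vector fields
    (∀ (p : D) (q : G) (X Y : 𝔤),
      ricciTensor covD p (invariantField φ (.inMid X) p) (invariantField φ (.inMid Y) p) =
          ricciTensor covG q (invariantField ψ X q) (invariantField ψ Y q) ∧
        ricciTensor covG q (invariantField ψ X q) (invariantField ψ Y q) =
          -(1 / 4) * killingForm ℝ 𝔤 X Y) ∧
    (∀ (p : D) (α : Module.Dual ℝ 𝔥) (z : DoubleExtension π),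
      ricciTensor covD p (invariantField φ (.inDual α) p) (invariantField φ z p) = 0 ∧
        ricciTensor covD p (invariantField φ z p) (invariantField φ (.inDual α) p) = 0) ∧
    (∀ (p : D) (H H' : 𝔥),
      ricciTensor covD p (invariantField φ (.inTop H) p) (invariantField φ (.inTop H') p) =
        -(1 / 4) * (LinearMap.trace ℝ 𝔤 (skewAction π H ∘ₗ skewAction π H')
          + 2 * killingForm ℝ 𝔥 H H')) ∧
    (∀ (p : D) (X : 𝔤) (H : 𝔥),
      ricciTensor covD p (invariantField φ (.inMid X) p) (invariantField φ (.inTop H) p) =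
          -(1 / 4) * LinearMap.trace ℝ 𝔤 (LieAlgebra.ad ℝ 𝔤 X ∘ₗ skewAction π H) ∧
        ricciTensor covD p (invariantField φ (.inTop H) p) (invariantField φ (.inMid X) p) =
          -(1 / 4) * LinearMap.trace ℝ 𝔤 (LieAlgebra.ad ℝ 𝔤 X ∘ₗ skewAction π H)) ∧
    -- the scalar curvature
    (∀ (p : D) (q : G),
      scalarCurvature covD φ (DoubleExtension.scalarProduct π Bh) p =
          scalarCurvature covG ψ Bg q ∧
        scalarCurvature covG ψ Bg q =
          -(1 / 4) * metricTrace Bg.form Bg.nondegenerate (killingForm ℝ 𝔤)) ∧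
    -- the criterion for a 2-step nilpotent Ricci tensor, in any orthonormal basis of `𝔤`
    (∀ (n : ℕ) (b : Module.Basis (Fin n) ℝ 𝔤) (ε : Fin n → ℝ),
      IsPseudoOrthonormal Bg.form b ε →
      (IsRicciTwoStepNilpotent covD φ (DoubleExtension.scalarProduct π Bh) ↔
        IsRicciTwoStepNilpotent covG ψ Bg ∧
        (∀ (H : 𝔥) (X : 𝔤),
          ∑ j, ε j * killingForm ℝ 𝔤 X (b j) *
            LinearMap.trace ℝ 𝔤 (LieAlgebra.ad ℝ 𝔤 (b j) ∘ₗ skewAction π H) = 0) ∧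
        (∀ H H' : 𝔥,
          ∑ j, ε j * LinearMap.trace ℝ 𝔤 (LieAlgebra.ad ℝ 𝔤 (b j) ∘ₗ skewAction π H) *
            LinearMap.trace ℝ 𝔤 (LieAlgebra.ad ℝ 𝔤 (b j) ∘ₗ skewAction π H') = 0))) ∧
    -- the criterion for Ricci-flatness
    ((∀ p : D, ricciTensor covD p = 0) ↔
      killingForm ℝ 𝔤 = 0 ∧
      (∀ (X : 𝔤) (H : 𝔥),
        LinearMap.trace ℝ 𝔤 (LieAlgebra.ad ℝ 𝔤 X ∘ₗ skewAction π H) = 0) ∧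
      (∀ H H' : 𝔥,
        LinearMap.trace ℝ 𝔤 (skewAction π H ∘ₗ skewAction π H')
          + 2 * killingForm ℝ 𝔥 H H' = 0)) := by
  have hsymm := LieModule.traceForm_comm ℝ (DoubleExtension π) (DoubleExtension π)
  refine ⟨fun p q X Y => ⟨?_, ?_⟩, fun p α z => ⟨?_, ?_⟩, fun p H H' => ?_,
    fun p X H => ⟨?_, ?_⟩, fun p q => ⟨?_, ?_⟩, fun n b ε hb => ?_, ?_⟩
  · rw [ricciTensor_invariantField hD, ricciTensor_invariantField hG,
      DoubleExtension.killingForm_inMid_inMid]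
  · rw [ricciTensor_invariantField hG]
  · rw [ricciTensor_invariantField hD, hsymm, DoubleExtension.killingForm_inDual, mul_zero]
  · rw [ricciTensor_invariantField hD, DoubleExtension.killingForm_inDual, mul_zero]
  · rw [ricciTensor_invariantField hD, DoubleExtension.killingForm_inTop_inTop]
  · rw [ricciTensor_invariantField hD, hsymm, DoubleExtension.killingForm_inTop_inMid]
  · rw [ricciTensor_invariantField hD, DoubleExtension.killingForm_inTop_inMid]
  · rw [scalarCurvature_eq hD, scalarCurvature_eq hG, DoubleExtension.metricTrace_killingForm]
  · rw [scalarCurvature_eq hG]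
  · rw [isRicciTwoStepNilpotent_iff hD, isRicciTwoStepNilpotent_iff hG]
    exact DoubleExtension.killingOperator_isotropic_iff hb
  · rw [ricciTensor_eq_zero_iff hD, DoubleExtension.killingForm_eq_zero_iff]
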